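/- Let $(M,g)$ be a smooth Riemannian $n$-manifold with Levi-Civita connection $\nabla$, and let $T$ be a smooth unit vector field on $M$ with geodesic flow ($\nabla_T T=0$) whose normal bundle $T^{\perp}=\{v\in TM : g(T,v)=0\}$ is integrable (through every point of $M$ passes an integral manifold of $T^\perp$). Let $T^\flat=g(T,\cdot)$, let $(\nabla T^\flat)(X,Y)=X(T^\flat(Y))-T^\flat(\nabla_XY)$ be its covariant derivative, and set $g_L := g-2\,T^\flat\otimes T^\flat$. Then the $2$-tensor $\nabla T^\flat$ is symmetric, $g_L$ is a Lorentzian metric (of signature $(-,+,\dots,+)$), and the Riemann curvature $4$-tensors $\mathrm{Rm}$ of $g$ and $\mathrm{Rm}_L$ of $g_L$ satisfy $$\mathrm{Rm}_L=\mathrm{Rm}+\nabla T^\flat\owedge\nabla T^\flat .$$ Here, for a (pseudo-)Riemannian metric $g$ with Levi-Civita connection $\nabla$, $\mathrm{Rm}(a,b,c,d)=g(\nabla_a\nabla_bc,d)-g(\nabla_b\nabla_ac,d)-g(\nabla_{[a,b]}c,d)$, and for symmetric $2$-tensors $h,k$, $(h\owedge k)(a,b,c,d)=h(a,d)k(b,c)+h(b,c)k(a,d)-h(a,c)k(b,d)-h(b,d)k(a,c)$.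 -/

import Mathlib

open Bundle VectorField
open scoped Manifold ContDiff

noncomputable section

/-- A (smooth) pseudo-Riemannian metric on `M`: a smooth symmetric nondegenerate
`(0,2)`-tensor field. -/
structure PseudoRiemannianMetric {E : Type*} [NormedAddCommGroup E] [NormedSpace ℝ E]
    {H : Type*} [TopologicalSpace H] (I : ModelWithCorners ℝ E H)
    (M : Type*) [TopologicalSpace M] [ChartedSpace H M] [IsManifold I ∞ M] where
  /-- The bilinear form on the tangent space at `x`. -/
  form (x : M) : TangentSpace I x →L[ℝ] TangentSpace I x →L[ℝ] ℝ
  symm (x : M) (v w : TangentSpace I x) : form x v w = form x w v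
  nondegenerate (x : M) (v : TangentSpace I x) (hv : ∀ w, form x v w = 0) : v = 0
  contMDiff : ContMDiff I (I.prod 𝓘(ℝ, E →L[ℝ] E →L[ℝ] ℝ)) ∞
    (fun x ↦ TotalSpace.mk' (E →L[ℝ] E →L[ℝ] ℝ)
      (E := fun x : M ↦ TangentSpace I x →L[ℝ] TangentSpace I x →L[ℝ] ℝ) x (form x))

namespace PseudoRiemannianMetric

variable {E : Type*} [NormedAddCommGroup E] [NormedSpace ℝ E]
  {H : Type*} [TopologicalSpace H] {I : ModelWithCorners ℝ E H}
  {M : Type*} [TopologicalSpace M] [ChartedSpace H M] [IsManifold I ∞ M]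

/-- The function `x ↦ g(Y, Z)(x)`. -/
def pair (g : PseudoRiemannianMetric I M) (Y Z : Π x : M, TangentSpace I x) : M → ℝ :=
  fun x ↦ g.form x (Y x) (Z x)

/-- `g` is Lorentzian: its signature is `(-, +, …, +)`, i.e. at every point there is a timelike
vector on whose orthogonal complement `g` is positive definite. -/
def IsLorentzian (g : PseudoRiemannianMetric I M) : Prop :=
  ∀ x : M, ∃ t : TangentSpace I x, g.form x t t < 0 ∧
    ∀ v : TangentSpace I x, g.form x t v = 0 → v ≠ 0 → 0 < g.form x v v

/-- The right-hand side of the Koszul formula for `g(∇_X Y, Z)` at `x`. -/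
def koszul (g : PseudoRiemannianMetric I M) (X Y Z : Π x : M, TangentSpace I x) (x : M) : ℝ :=
  (d% (g.pair Y Z) x (X x) + d% (g.pair Z X) x (Y x) - d% (g.pair X Y) x (Z x)
    + g.pair (mlieBracket I X Y) Z x - g.pair (mlieBracket I Y Z) X x
    + g.pair (mlieBracket I Z X) Y x) / 2

variable (g : PseudoRiemannianMetric I M) {X X' Y Y' Z Z' : Π x : M, TangentSpace I x} {x : M}

lemma pair_comm (Y Z : Π x : M, TangentSpace I x) : g.pair Y Z = g.pair Z Y :=
  funext fun x ↦ g.symm x _ _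

lemma mdifferentiableAt_pair (hY : MDiffAt (T% Y) x) (hZ : MDiffAt (T% Z) x) :
    MDiffAt (g.pair Y Z) x := by
  have : MDifferentiableAt I (I.prod 𝓘(ℝ))
      (fun m ↦ TotalSpace.mk' ℝ (E := Bundle.Trivial M ℝ) m (g.form m (Y m) (Z m))) x := by
    apply MDifferentiableAt.clm_bundle_apply₂ (F₁ := E) (F₂ := E)
      (b := fun m : M ↦ m)
    · exact g.contMDiff.mdifferentiableAt (by simp)
    · exact hY
    · exact hZ
  simp only [mdifferentiableAt_totalSpace] at this
  exact this.2

lemma pair_add_left (Y Y' Z : Π x : M, TangentSpace I x) :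
    g.pair (Y + Y') Z = g.pair Y Z + g.pair Y' Z := by
  ext x; simp [pair]

lemma pair_add_right (Y Z Z' : Π x : M, TangentSpace I x) :
    g.pair Y (Z + Z') = g.pair Y Z + g.pair Y Z' := by
  ext x; simp [pair]

lemma pair_smul_left (f : M → ℝ) (Y Z : Π x : M, TangentSpace I x) :
    g.pair (f • Y) Z = f * g.pair Y Z := by
  ext x; simp [pair]

lemma pair_smul_right (f : M → ℝ) (Y Z : Π x : M, TangentSpace I x) :
    g.pair Y (f • Z) = f * g.pair Y Z := by
  ext x; simp [pair]

section

variable [FiniteDimensional ℝ E]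

instance (x : M) : FiniteDimensional ℝ (TangentSpace I x) :=
  inferInstanceAs (FiniteDimensional ℝ E)

instance (x : M) : T2Space (TangentSpace I x) :=
  inferInstanceAs (T2Space E)

/-- The musical isomorphism `v ↦ g(v, ·)`. -/
def flat (x : M) : TangentSpace I x ≃ₗ[ℝ] Module.Dual ℝ (TangentSpace I x) :=
  LinearMap.linearEquivOfInjective
    (ContinuousLinearMap.coeLM ℝ ∘ₗ (g.form x).toLinearMap)
    ((injective_iff_map_eq_zero _).2 fun v hv ↦ g.nondegenerate x v fun w ↦ LinearMap.congr_fun hv w)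
    Subspace.dual_finrank_eq.symm

lemma flat_apply (x : M) (v w : TangentSpace I x) : g.flat x v w = g.form x v w := rfl

lemma ext_form {v v' : TangentSpace I x} (h : ∀ w, g.form x v w = g.form x v' w) : v = v' :=
  (g.flat x).injective (LinearMap.ext h)

lemma ext_pair (h : ∀ Z : Π x : M, TangentSpace I x, MDiffAt (T% Z) x →
    g.pair Y Z x = g.pair Y' Z x) : Y x = Y' x :=
  g.ext_form fun w ↦ by
    simpa [pair] using h (FiberBundle.extend E w) (FiberBundle.mdifferentiableAt_extend ..)

end

variable [CompleteSpace E]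

lemma koszul_add_right (hX : MDiffAt (T% X) x) (hY : MDiffAt (T% Y) x) (hZ : MDiffAt (T% Z) x)
    (hZ' : MDiffAt (T% Z') x) :
    g.koszul X Y (Z + Z') x = g.koszul X Y Z x + g.koszul X Y Z' x := by
  have h1 := mvfderiv_add (g.mdifferentiableAt_pair hY hZ) (g.mdifferentiableAt_pair hY hZ')
  have h2 := mvfderiv_add (g.mdifferentiableAt_pair hZ hX) (g.mdifferentiableAt_pair hZ' hX)
  simp only [koszul, pair_add_right, pair_add_left, h1, h2]
  simp only [pair, mlieBracket_add_left hZ hZ', mlieBracket_add_right hZ hZ', Pi.add_apply,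
    map_add, add_apply]
  ring

lemma koszul_smul_right {f : M → ℝ} (hf : MDiffAt f x) (hX : MDiffAt (T% X) x)
    (hY : MDiffAt (T% Y) x) (hZ : MDiffAt (T% Z) x) :
    g.koszul X Y (f • Z) x = f x * g.koszul X Y Z x := by
  have h1 := mvfderiv_mul hf (g.mdifferentiableAt_pair hY hZ)
  have h2 := mvfderiv_mul hf (g.mdifferentiableAt_pair hZ hX)
  simp only [koszul, pair_smul_right, pair_smul_left, h1, h2]
  simp only [pair, mlieBracket_smul_left hf hZ, mlieBracket_smul_right hf hZ, Pi.smul_apply',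
    map_add, map_smul, map_neg, add_apply, smul_apply,
    neg_apply, smul_eq_mul, neg_smul, Pi.mul_apply]
  rw [g.symm x (Z x) (Y x), g.symm x (Z x) (X x)]
  ring

lemma koszul_add_left (hX : MDiffAt (T% X) x) (hX' : MDiffAt (T% X') x) (hY : MDiffAt (T% Y) x)
    (hZ : MDiffAt (T% Z) x) :
    g.koszul (X + X') Y Z x = g.koszul X Y Z x + g.koszul X' Y Z x := by
  have h1 := mvfderiv_add (g.mdifferentiableAt_pair hZ hX) (g.mdifferentiableAt_pair hZ hX')
  have h2 := mvfderiv_add (g.mdifferentiableAt_pair hX hY) (g.mdifferentiableAt_pair hX' hY)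
  simp only [koszul, pair_add_right, pair_add_left, h1, h2]
  simp only [pair, mlieBracket_add_left hX hX', mlieBracket_add_right hX hX', Pi.add_apply,
    map_add, add_apply]
  ring

lemma koszul_smul_left {f : M → ℝ} (hf : MDiffAt f x) (hX : MDiffAt (T% X) x)
    (hY : MDiffAt (T% Y) x) (hZ : MDiffAt (T% Z) x) :
    g.koszul (f • X) Y Z x = f x * g.koszul X Y Z x := by
  have h1 := mvfderiv_mul hf (g.mdifferentiableAt_pair hZ hX)
  have h2 := mvfderiv_mul hf (g.mdifferentiableAt_pair hX hY)
  simp only [koszul, pair_smul_right, pair_smul_left, h1, h2]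
  simp only [pair, mlieBracket_smul_left hf hX, mlieBracket_smul_right hf hX, Pi.smul_apply',
    map_add, map_smul, map_neg, add_apply, smul_apply,
    neg_apply, smul_eq_mul, neg_smul, Pi.mul_apply]
  rw [g.symm x (Z x) (X x), g.symm x (X x) (Y x)]
  ring

lemma koszul_add_mid (hX : MDiffAt (T% X) x) (hY : MDiffAt (T% Y) x) (hY' : MDiffAt (T% Y') x)
    (hZ : MDiffAt (T% Z) x) :
    g.koszul X (Y + Y') Z x = g.koszul X Y Z x + g.koszul X Y' Z x := by
  have h1 := mvfderiv_add (g.mdifferentiableAt_pair hY hZ) (g.mdifferentiableAt_pair hY' hZ)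
  have h2 := mvfderiv_add (g.mdifferentiableAt_pair hX hY) (g.mdifferentiableAt_pair hX hY')
  simp only [koszul, pair_add_right, pair_add_left, h1, h2]
  simp only [pair, mlieBracket_add_left hY hY', mlieBracket_add_right hY hY', Pi.add_apply,
    map_add, add_apply]
  ring

lemma koszul_smul_mid {f : M → ℝ} (hf : MDiffAt f x) (hX : MDiffAt (T% X) x)
    (hY : MDiffAt (T% Y) x) (hZ : MDiffAt (T% Z) x) :
    g.koszul X (f • Y) Z x = f x * g.koszul X Y Z x + d% f x (X x) * g.pair Y Z x := by
  have h1 := mvfderiv_mul hf (g.mdifferentiableAt_pair hY hZ)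
  have h2 := mvfderiv_mul hf (g.mdifferentiableAt_pair hX hY)
  simp only [koszul, pair_smul_right, pair_smul_left, h1, h2]
  simp only [pair, mlieBracket_smul_left hf hY, mlieBracket_smul_right hf hY, Pi.smul_apply',
    map_add, map_smul, map_neg, add_apply, smul_apply,
    neg_apply, smul_eq_mul, neg_smul, Pi.mul_apply]
  rw [g.symm x (Y x) (X x)]
  ring

lemma tensorialAt_koszul_left (hY : MDiffAt (T% Y) x) (Z : Π x : M, TangentSpace I x)
    (hZ : MDiffAt (T% Z) x) : TensorialAt I E (fun X ↦ g.koszul X Y Z x) x where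
  smul hf hX := g.koszul_smul_left hf hX hY hZ
  add hX hX' := g.koszul_add_left hX hX' hY hZ

lemma tensorialAt_koszul_right (hY : MDiffAt (T% Y) x) (X : Π x : M, TangentSpace I x)
    (hX : MDiffAt (T% X) x) : TensorialAt I E (fun Z ↦ g.koszul X Y Z x) x where
  smul hf hZ := g.koszul_smul_right hf hX hY hZ
  add hZ hZ' := g.koszul_add_right hX hY hZ hZ'

variable [FiniteDimensional ℝ E]

open scoped Classical in
/-- The bilinear form `(u, w) ↦ g(∇_u Y, w)` on the tangent space at `x`. -/
def koszulForm (Y : Π x : M, TangentSpace I x) (x : M) :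
    TangentSpace I x →L[ℝ] TangentSpace I x →L[ℝ] ℝ :=
  if hY : MDiffAt (T% Y) x then
    TensorialAt.mkHom₂ (fun X Z ↦ g.koszul X Y Z x) x
      (g.tensorialAt_koszul_left hY) (g.tensorialAt_koszul_right hY)
  else 0

lemma koszulForm_apply (hX : MDiffAt (T% X) x) (hY : MDiffAt (T% Y) x) (hZ : MDiffAt (T% Z) x) :
    g.koszulForm Y x (X x) (Z x) = g.koszul X Y Z x := by
  rw [koszulForm, dif_pos hY]
  exact TensorialAt.mkHom₂_apply _ _ hX hZ

/-- The covariant derivative `u ↦ ∇_u Y`, defined by `g(∇_u Y, ·) = koszulForm Y u`. -/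
def leviCivitaAux (Y : Π x : M, TangentSpace I x) (x : M) :
    TangentSpace I x →L[ℝ] TangentSpace I x :=
  LinearMap.toContinuousLinearMap
    ((g.flat x).symm.toLinearMap ∘ₗ ContinuousLinearMap.coeLM ℝ ∘ₗ (g.koszulForm Y x).toLinearMap)

lemma form_leviCivitaAux (Y : Π x : M, TangentSpace I x) (u w : TangentSpace I x) :
    g.form x (g.leviCivitaAux Y x u) w = g.koszulForm Y x u w := by
  rw [← flat_apply]
  simp [leviCivitaAux]

lemma pair_leviCivitaAux (hX : MDiffAt (T% X) x) (hY : MDiffAt (T% Y) x) (hZ : MDiffAt (T% Z) x) :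
    g.pair (fun x ↦ g.leviCivitaAux Y x (X x)) Z x = g.koszul X Y Z x := by
  rw [pair, form_leviCivitaAux, koszulForm_apply g hX hY hZ]

/-- The Levi-Civita connection of a pseudo-Riemannian metric, defined by the Koszul formula. -/
def leviCivita : CovariantDerivative I E (fun x : M ↦ TangentSpace I x) where
  toFun := g.leviCivitaAux
  isCovariantDerivativeOnUniv :=
    { add := by
        intro Y Y' x hY hY' _
        apply VectorBundle.injective_eval_mdifferentiableAt_sec I E (fun x : M ↦ TangentSpace I x)
        ext X hX
        refine g.ext_pair (Y := fun x ↦ g.leviCivitaAux (Y + Y') x (X x))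
          (Y' := (fun x ↦ g.leviCivitaAux Y x (X x)) + fun x ↦ g.leviCivitaAux Y' x (X x))
          fun Z hZ ↦ ?_
        rw [pair_add_left, Pi.add_apply,
          pair_leviCivitaAux g hX (mdifferentiableAt_add_section hY hY') hZ,
          pair_leviCivitaAux g hX hY hZ, pair_leviCivitaAux g hX hY' hZ,
          koszul_add_mid g hX hY hY' hZ]
      leibniz := by
        intro Y f x hY hf _
        apply VectorBundle.injective_eval_mdifferentiableAt_sec I E (fun x : M ↦ TangentSpace I x)
        ext X hX
        refine g.ext_pair (Y := fun x ↦ g.leviCivitaAux (f • Y) x (X x))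
          (Y' := f • (fun x ↦ g.leviCivitaAux Y x (X x)) + (fun x ↦ d% f x (X x)) • Y)
          fun Z hZ ↦ ?_
        rw [pair_add_left, pair_smul_left, pair_smul_left, Pi.add_apply, Pi.mul_apply, Pi.mul_apply,
          pair_leviCivitaAux g hX (hf.smul_section hY) hZ,
          pair_leviCivitaAux g hX hY hZ, koszul_smul_mid g hf hX hY hZ] }

/-- The vector field `∇_X Y`. -/
def nabla (X Y : Π x : M, TangentSpace I x) (x : M) : TangentSpace I x :=
  g.leviCivita Y x (X x)

lemma pair_nabla (hX : MDiffAt (T% X) x) (hY : MDiffAt (T% Y) x) (hZ : MDiffAt (T% Z) x) :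
    g.pair (g.nabla X Y) Z x = g.koszul X Y Z x :=
  g.pair_leviCivitaAux hX hY hZ

/-- The Levi-Civita connection is torsion free. -/
theorem nabla_sub_nabla (hX : MDiffAt (T% X) x) (hY : MDiffAt (T% Y) x) :
    g.nabla X Y x - g.nabla Y X x = mlieBracket I X Y x := by
  rw [sub_eq_iff_eq_add]
  refine g.ext_pair (Y' := mlieBracket I X Y + g.nabla Y X) fun Z hZ ↦ ?_
  rw [pair_add_left, Pi.add_apply, pair_nabla g hX hY hZ, pair_nabla g hY hX hZ, koszul, koszul,
    g.pair_comm Y Z, g.pair_comm Z X, g.pair_comm X Y, mlieBracket_swap (V := Y) (W := X),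
    mlieBracket_swap (V := X) (W := Z), mlieBracket_swap (V := Z) (W := Y)]
  simp only [pair, Pi.neg_apply, map_neg, neg_apply]
  ring

/-- The Levi-Civita connection is compatible with the metric. -/
theorem mvfderiv_pair (hX : MDiffAt (T% X) x) (hY : MDiffAt (T% Y) x) (hZ : MDiffAt (T% Z) x) :
    d% (g.pair Y Z) x (X x) = g.pair (g.nabla X Y) Z x + g.pair Y (g.nabla X Z) x := by
  rw [g.pair_comm Y (g.nabla X Z), pair_nabla g hX hY hZ, pair_nabla g hX hZ hY, koszul, koszul,
    g.pair_comm Z Y, g.pair_comm X Z, g.pair_comm Y X, mlieBracket_swap (V := X) (W := Z),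
    mlieBracket_swap (V := Z) (W := Y), mlieBracket_swap (V := Y) (W := X)]
  simp only [pair, Pi.neg_apply, map_neg, neg_apply]
  ring

/-- The Riemann curvature 4-tensor, evaluated on vector fields:
`Rm(a, b, c, d) = g(∇_a ∇_b c, d) - g(∇_b ∇_a c, d) - g(∇_[a,b] c, d)`. -/
def Rm (a b c d : Π x : M, TangentSpace I x) (x : M) : ℝ :=
  g.pair (g.nabla a (g.nabla b c)) d x - g.pair (g.nabla b (g.nabla a c)) d x
    - g.pair (g.nabla (mlieBracket I a b) c) d x

/-- The covariant derivative of a one-form `α`, evaluated on vector fields: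
`(∇α)(X, Y) = (∇_X α)(Y) = X(α(Y)) - α(∇_X Y)`. -/
def nablaForm (α : Π x : M, TangentSpace I x →L[ℝ] ℝ) (X Y : Π x : M, TangentSpace I x)
    (x : M) : ℝ :=
  d% (fun y ↦ α y (Y y)) x (X x) - α x (g.nabla X Y x)

/-- The one-form `T♭ = g(T, ·)`. -/
def flatForm (T : Π x : M, TangentSpace I x) (x : M) : TangentSpace I x →L[ℝ] ℝ :=
  g.form x (T x)

/-- The normal bundle of `T`: the distribution `T^⊥ = {v | g(T, v) = 0}`. -/
def normalBundle (T : Π x : M, TangentSpace I x) (x : M) : Submodule ℝ (TangentSpace I x) :=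
  LinearMap.ker (g.flatForm T x).toLinearMap

/-- `T` has geodesic flow: `∇_T T = 0`. -/
def HasGeodesicFlow (T : Π x : M, TangentSpace I x) : Prop :=
  ∀ x, g.nabla T T x = 0

end PseudoRiemannianMetric

section

variable {E : Type*} [NormedAddCommGroup E] [NormedSpace ℝ E]
  {H : Type*} [TopologicalSpace H] {I : ModelWithCorners ℝ E H}
  {M : Type*} [TopologicalSpace M] [ChartedSpace H M] [IsManifold I ∞ M]

/-- A distribution `D` on `M` is integrable if through every point `x` there passes an integral
manifold of `D`, given here by a local parametrization: a smooth immersion `φ` of an open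
neighbourhood `U` of `0` in a Euclidean space with `φ 0 = x` whose tangent spaces are those
of `D`. -/
def IsIntegrableDistribution (D : Π x : M, Submodule ℝ (TangentSpace I x)) : Prop :=
  ∀ x : M, ∃ (k : ℕ) (U : Set (EuclideanSpace ℝ (Fin k))) (φ : EuclideanSpace ℝ (Fin k) → M),
    IsOpen U ∧ 0 ∈ U ∧ φ 0 = x ∧ ContMDiffOn (𝓡 k) I ∞ φ U ∧
    ∀ s ∈ U, Function.Injective (mfderiv (𝓡 k) I φ s) ∧
      LinearMap.range (mfderiv (𝓡 k) I φ s).toLinearMap = D (φ s)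

/-- A Riemannian metric as a pseudo-Riemannian metric. -/
def PseudoRiemannianMetric.ofRiemannian
    (g : ContMDiffRiemannianMetric I ∞ E (fun x : M ↦ TangentSpace I x)) :
    PseudoRiemannianMetric I M where
  form := g.inner
  symm := g.symm
  nondegenerate x v hv := by
    by_contra h
    exact (g.pos x v h).ne' (hv v)
  contMDiff := g.contMDiff

/-- The tensor field `T♭ ⊗ T♭` is smooth. -/
lemma contMDiff_flat_smulRight_flat
    (g : ContMDiffRiemannianMetric I ∞ E (fun x : M ↦ TangentSpace I x))
    {T : Π x : M, TangentSpace I x} (hT : ContMDiff I I.tangent ∞ (T% T)) :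
    ContMDiff I (I.prod 𝓘(ℝ, E →L[ℝ] E →L[ℝ] ℝ)) ∞
    (fun x ↦ TotalSpace.mk' (E →L[ℝ] E →L[ℝ] ℝ)
      (E := fun x : M ↦ TangentSpace I x →L[ℝ] TangentSpace I x →L[ℝ] ℝ) x
      ((g.inner x (T x)).smulRight (g.inner x (T x)))) := by
  have hα : ContMDiff I (I.prod 𝓘(ℝ, E →L[ℝ] ℝ)) ∞
      (fun x ↦ TotalSpace.mk' (E →L[ℝ] ℝ) (E := fun x : M ↦ TangentSpace I x →L[ℝ] ℝ) x
        (g.inner x (T x))) := by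
    exact ContMDiff.clm_bundle_apply (F₁ := E) (F₂ := E →L[ℝ] ℝ) (b := fun x : M ↦ x)
      (E₂ := fun x : M ↦ TangentSpace I x →L[ℝ] ℝ) g.contMDiff hT
  intro x
  have h := hα x
  rw [contMDiffAt_hom_bundle] at h ⊢
  refine ⟨contMDiffAt_id, ?_⟩
  have hc : ContDiff ℝ ∞ (fun L : E →L[ℝ] ℝ ↦ L.smulRight L) :=
    contDiff_id.smulRight contDiff_id
  have h' := hc.contMDiff.contMDiffAt.comp x h.2
  refine h'.congr_of_eventuallyEq ?_
  have hx : ∀ᶠ y in nhds x, y ∈ (trivializationAt E (TangentSpace I) x).baseSet :=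
    (trivializationAt E (TangentSpace I) x).open_baseSet.mem_nhds
      (FiberBundle.mem_baseSet_trivializationAt' x)
  filter_upwards [hx] with y hy
  ext u v
  have key : ∀ w : E, ContinuousLinearMap.inCoordinates E (fun x : M ↦ TangentSpace I x) ℝ
      (Bundle.Trivial M ℝ) x y x y (g.inner y (T y)) w
      = g.inner y (T y) ((trivializationAt E (TangentSpace I) x).symm y w) := by
    intro w
    simp only [ContinuousLinearMap.inCoordinates, ContinuousLinearMap.comp_apply]
    rw [Bundle.Trivialization.symmL_apply _ hy]
    simp
  have key2 := inCoordinates_apply_eq₂ (F₁ := E) (F₂ := E) (F₃ := ℝ)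
    (E₁ := fun x : M ↦ TangentSpace I x)
    (E₂ := fun x : M ↦ TangentSpace I x) (E₃ := Bundle.Trivial M ℝ) (x₀ := x) (x := y)
    (ϕ := (g.inner y (T y)).smulRight (g.inner y (T y))) (v := u) (w := v) hy hy (Set.mem_univ _)
  refine key2.trans ?_
  simp only [Function.comp_apply, ContinuousLinearMap.smulRight_apply]
  refine Eq.trans ?_ (congrArg₂ (· * ·) (key u) (key v)).symm
  simp

/-- The Lorentzian counterpart `g_L = g - 2 T♭ ⊗ T♭` of a Riemannian metric `g` and a unit vector
field `T`. -/
def lorentzCounterpart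
    (g : ContMDiffRiemannianMetric I ∞ E (fun x : M ↦ TangentSpace I x))
    (T : Π x : M, TangentSpace I x) (hT : ContMDiff I I.tangent ∞ (T% T))
    (hunit : ∀ x, g.inner x (T x) (T x) = 1) : PseudoRiemannianMetric I M where
  form x := g.inner x - (2 : ℝ) • (g.inner x (T x)).smulRight (g.inner x (T x))
  symm x v w := by
    simp [g.symm x v w, mul_comm]
  nondegenerate x v hv := by
    have h1 : g.inner x v (T x) = 0 := by
      have := hv (T x)
      simp [hunit, g.symm x (T x) v] at this
      linarith
    by_contra h
    apply (g.pos x v h).ne'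
    have := hv v
    simpa [g.symm x (T x) v, h1] using this
  contMDiff := by
    exact ContMDiff.sub_section g.contMDiff
      (ContMDiff.const_smul_section (a := (2 : ℝ)) (contMDiff_flat_smulRight_flat g hT))

end

/-- The Kulkarni–Nomizu product of two symmetric 2-tensors. -/
def kulkarniNomizu {V : Type*} (h k : V → V → ℝ) (a b c d : V) : ℝ :=
  h a d * k b c + h b c * k a d - h a c * k b d - h b d * k a c

end

/-!
Write `h(X, Y) = (∇T♭)(X, Y)`. As `∇` is metric, `h(X, Y) = g(∇_X T, Y)`
(`PseudoRiemannianMetric.nablaForm_flatForm`).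

*Symmetry.* The antisymmetrization of `h` is `dT♭`. It vanishes on `T^⊥ × T^⊥`, because `T♭` pulls
back to zero on the integral manifolds of `T^⊥` (`mvfderiv_coordField_comm`); and
`h(T, ·) = g(∇_T T, ·) = 0` since `T` is geodesic, `h(·, T) = 0` since `T` has constant length.

*Connection.* Since `h` is symmetric, `∇_X Y + 2 h(X, Y) T` is torsion free, and a direct
computation shows that it is metric for `g_L`; by uniqueness it is the Levi-Civita connection of
`g_L` (`nabla_lorentzCounterpart`).

*Curvature.* Expanding `∇^L_a ∇^L_b c` (`nabla_nabla_lorentzCounterpart`) gives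
`R_L(a, b)c = R(a, b)c + 2 h(b, c) ∇_a T - 2 h(a, c) ∇_b T - 2 T♭(R(a, b)c) T`, where the second
derivatives of the function `T♭(c)` have disappeared by `[a, b] = ab - ba`. Pairing with `d` by
`g_L = g - 2 T♭ ⊗ T♭`, the last term cancels the correction `- 2 T♭(R(a, b)c) T♭(d)`, and what
remains is `Rm + h ∧ h` for the Kulkarni–Nomizu product.

The expansion differentiates `∇_b c`, which is defined pointwise from the Koszul formula; its
smoothness is `PseudoRiemannianMetric.contMDiffAt_nabla`.
-/

/-! ### Derivatives along vector fields -/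

section Calculus

variable {E : Type*} [NormedAddCommGroup E] [NormedSpace ℝ E]
  {H : Type*} [TopologicalSpace H] {I : ModelWithCorners ℝ E H}
  {M : Type*} [TopologicalSpace M] [ChartedSpace H M]

lemma contMDiffAt_det {ι : Type*} [Fintype ι] [DecidableEq ι] {A : M → Matrix ι ι ℝ} {x : M}
    (hA : ∀ i j, CMDiffAt ∞ (fun y ↦ A y i j) x) : CMDiffAt ∞ (fun y ↦ (A y).det) x := by
  simp only [Matrix.det_apply']
  exact ContMDiffAt.sum fun σ _ ↦ contMDiffAt_const.mul (ContMDiffAt.prod fun i _ ↦ hA _ _)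

variable [IsManifold I ∞ M] {X Y Z : Π x : M, TangentSpace I x} {x : M}

lemma isManifold_minSmoothness (I : ModelWithCorners ℝ E H) (M : Type*) [TopologicalSpace M]
    [ChartedSpace H M] [IsManifold I ∞ M] (k : ℕ) : IsManifold I (minSmoothness ℝ k) M := by
  rw [minSmoothness_of_isRCLikeNormedField]
  exact IsManifold.of_le (n := ∞) (by exact_mod_cast le_top)

lemma contMDiffAt_mvfderiv_apply {f : M → ℝ} (hf : CMDiffAt ∞ f x) (hX : CMDiffAt ∞ (T% X) x) :
    CMDiffAt ∞ (fun y ↦ d% f y (X y)) x := by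
  have h1 : ContMDiffAt I 𝓘(ℝ, ℝ).tangent ∞
      (fun y ↦ (TotalSpace.mk' ℝ (E := fun t : ℝ ↦ TangentSpace 𝓘(ℝ, ℝ) t)
      (f y) (mfderiv I 𝓘(ℝ, ℝ) f y (X y)))) x := by
    refine ContMDiffAt.clm_apply_of_inCoordinates (F₁ := E) (F₂ := ℝ)
      (b₁ := fun y : M ↦ y) (b₂ := f) (E₁ := fun y : M ↦ TangentSpace I y)
      (E₂ := fun t : ℝ ↦ TangentSpace 𝓘(ℝ, ℝ) t) ?_ hX hf
    exact ContMDiffAt.mfderiv_const (m := ∞) hf le_rfl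
  exact (contMDiff_snd_tangentBundle_modelSpace ℝ 𝓘(ℝ, ℝ)).contMDiffAt.comp x h1

lemma ContMDiffAt.eventually_mdifferentiableAt_section (hX : CMDiffAt ∞ (T% X) x) :
    ∀ᶠ y in nhds x, MDiffAt (T% X) y := by
  filter_upwards [(contMDiffAt_iff_contMDiffAt_nhds (n := 1) (by simp)).1
    (hX.of_le (by simp))] with y hy using hy.mdifferentiableAt (by simp)

lemma ContMDiffAt.eventually_mdifferentiableAt {f : M → ℝ} (hf : CMDiffAt ∞ f x) :
    ∀ᶠ y in nhds x, MDiffAt f y := by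
  have : IsManifold I 1 M := IsManifold.of_le (n := ∞) (by simp)
  filter_upwards [(contMDiffAt_iff_contMDiffAt_nhds (n := 1) (by simp)).1
    (hf.of_le (by simp))] with y hy using hy.mdifferentiableAt (by simp)

lemma ContMDiffAt.mlieBracket_infty [CompleteSpace E]
    (hX : CMDiffAt ∞ (T% X) x) (hY : CMDiffAt ∞ (T% Y) x) :
    CMDiffAt ∞ (T% (mlieBracket I X Y)) x := by
  have : IsManifold I ((⊤ : ℕ∞) + 1) M := by simpa using ‹IsManifold I ∞ M›
  have : IsManifold I (minSmoothness ℝ 2) M := isManifold_minSmoothness I M 2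
  exact ContMDiffAt.mlieBracket_vectorField (m := ⊤) (n := ⊤) hX hY
    (by simp [minSmoothness_of_isRCLikeNormedField])

/-- The commutator formula `[X, Y] f = X (Y f) - Y (X f)`. It is the coefficient of `C` in the
Jacobi identity for `X`, `Y` and `f C`, where `C` is any vector field with `C x ≠ 0`. -/
lemma mvfderiv_mlieBracket_apply [CompleteSpace E] {f : M → ℝ} (hf : CMDiffAt ∞ f x)
    (hX : CMDiffAt ∞ (T% X) x) (hY : CMDiffAt ∞ (T% Y) x) :
    d% f x (mlieBracket I X Y x) =
      d% (fun y ↦ d% f y (Y y)) x (X x) - d% (fun y ↦ d% f y (X y)) x (Y x) := by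
  have : IsManifold I (minSmoothness ℝ 2) M := isManifold_minSmoothness I M 2
  have : IsManifold I (minSmoothness ℝ 3) M := isManifold_minSmoothness I M 3
  rcases subsingleton_or_nontrivial (TangentSpace I x) with hs | hs
  · simp [Subsingleton.elim (mlieBracket I X Y x) 0, Subsingleton.elim (X x) 0,
      Subsingleton.elim (Y x) 0]
  obtain ⟨v, hv⟩ := exists_ne (0 : TangentSpace I x)
  set C : Π y : M, TangentSpace I y := FiberBundle.extend E v
  have hCx : C x = v := by simp [C]
  have hC : CMDiffAt ∞ (T% C) x := FiberBundle.contMDiffAt_extend ..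
  have hfC : CMDiffAt ∞ (T% (f • C)) x := hf.smul_section hC
  have bracket : ∀ {V : Π y : M, TangentSpace I y},
      mlieBracket I V (f • C) =ᶠ[nhds x] (fun y ↦ d% f y (V y)) • C + f • mlieBracket I V C := by
    intro V
    filter_upwards [hf.eventually_mdifferentiableAt, hC.eventually_mdifferentiableAt_section]
      with y hfy hCy
    rw [mlieBracket_smul_right hfy hCy]
    rfl
  have double : ∀ {U V : Π y : M, TangentSpace I y}, CMDiffAt ∞ (T% U) x → CMDiffAt ∞ (T% V) x →
      mlieBracket I U (mlieBracket I V (f • C)) x =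
        d% (fun y ↦ d% f y (V y)) x (U x) • C x + d% f x (V x) • mlieBracket I U C x
        + d% f x (U x) • mlieBracket I V C x + f x • mlieBracket I U (mlieBracket I V C) x := by
    intro U V hU hV
    have hVf := contMDiffAt_mvfderiv_apply hf hV
    have hVC := hV.mlieBracket_infty hC
    rw [Filter.EventuallyEq.mlieBracket_vectorField_eq (.refl (nhds x) U) (bracket (V := V)),
      mlieBracket_add_right ((hVf.smul_section hC).mdifferentiableAt (by simp))
        ((hf.smul_section hVC).mdifferentiableAt (by simp)),
      mlieBracket_smul_right (hVf.mdifferentiableAt (by simp)) (hC.mdifferentiableAt (by simp)),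
      mlieBracket_smul_right (hf.mdifferentiableAt (by simp)) (hVC.mdifferentiableAt (by simp))]
    abel
  have two {V : Π y : M, TangentSpace I y} (hV : CMDiffAt ∞ (T% V) x) :
      CMDiffAt (minSmoothness ℝ 2) (T% V) x :=
    hV.of_le (by
      rw [minSmoothness_of_isRCLikeNormedField]
      exact WithTop.coe_le_coe.2 (le_top : (2 : ℕ∞) ≤ ⊤))
  have jac := leibniz_identity_mlieBracket_apply (two hX) (two hY) (two hfC)
  have jacC := leibniz_identity_mlieBracket_apply (two hX) (two hY) (two hC)
  rw [double hX hY, double hY hX, bracket.self_of_nhds, jacC] at jac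
  simp only [Pi.add_apply, Pi.smul_apply', hCx] at jac
  have key : (d% f x (mlieBracket I X Y x) - (d% (fun y ↦ d% f y (Y y)) x (X x)
      - d% (fun y ↦ d% f y (X y)) x (Y x))) • v = 0 := by
    linear_combination (norm := module) (-1 : ℝ) • jac
  exact sub_eq_zero.1 ((smul_eq_zero.1 key).resolve_right hv)

end Calculus

/-! ### Regularity and uniqueness of the Levi-Civita connection -/

namespace PseudoRiemannianMetric

section Regularity

variable {E : Type*} [NormedAddCommGroup E] [NormedSpace ℝ E]
  {H : Type*} [TopologicalSpace H] {I : ModelWithCorners ℝ E H}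
  {M : Type*} [TopologicalSpace M] [ChartedSpace H M] [IsManifold I ∞ M]
  (g : PseudoRiemannianMetric I M) {X Y Z : Π x : M, TangentSpace I x} {x : M}

lemma contMDiffAt_pair (hY : CMDiffAt ∞ (T% Y) x) (hZ : CMDiffAt ∞ (T% Z) x) :
    CMDiffAt ∞ (g.pair Y Z) x := by
  have : ContMDiffAt I (I.prod 𝓘(ℝ)) ∞
      (fun m ↦ TotalSpace.mk' ℝ (E := Bundle.Trivial M ℝ) m (g.form m (Y m) (Z m))) x := by
    apply ContMDiffAt.clm_bundle_apply₂ (F₁ := E) (F₂ := E) (b := fun m : M ↦ m)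
    · exact g.contMDiff x
    · exact hY
    · exact hZ
  simp only [contMDiffAt_totalSpace] at this
  exact this.2

variable [CompleteSpace E]

lemma contMDiffAt_koszul (hX : CMDiffAt ∞ (T% X) x) (hY : CMDiffAt ∞ (T% Y) x)
    (hZ : CMDiffAt ∞ (T% Z) x) : CMDiffAt ∞ (g.koszul X Y Z) x := by
  have h1 := contMDiffAt_mvfderiv_apply (g.contMDiffAt_pair hY hZ) hX
  have h2 := contMDiffAt_mvfderiv_apply (g.contMDiffAt_pair hZ hX) hY
  have h3 := contMDiffAt_mvfderiv_apply (g.contMDiffAt_pair hX hY) hZ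
  have h4 := g.contMDiffAt_pair (hX.mlieBracket_infty hY) hZ
  have h5 := g.contMDiffAt_pair (hY.mlieBracket_infty hZ) hX
  have h6 := g.contMDiffAt_pair (hZ.mlieBracket_infty hX) hY
  exact (((((h1.add h2).sub h3).add h4).sub h5).add h6).div_const 2

variable [FiniteDimensional ℝ E]

omit [CompleteSpace E] in
/-- A vector field is smooth as soon as its products with all smooth vector fields are: in a local
frame its coefficients are obtained by Cramer's rule from the Gram matrix of the frame. -/
lemma contMDiffAt_of_pair
    (h : ∀ Z : Π x : M, TangentSpace I x, CMDiffAt ∞ (T% Z) x → CMDiffAt ∞ (g.pair Y Z) x) :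
    CMDiffAt ∞ (T% Y) x := by
  classical
  let e := trivializationAt E (TangentSpace I) x
  have hx : x ∈ e.baseSet := FiberBundle.mem_baseSet_trivializationAt' x
  let b := Module.finBasis ℝ E
  let s := e.localFrame b
  have hs (i) : CMDiffAt ∞ (T% (s i)) x := contMDiffAt_localFrame_of_mem ∞ e b i hx
  let G (y : M) : Matrix _ _ ℝ := Matrix.of fun i j ↦ g.pair (s j) (s i) y
  have hG (i j) : CMDiffAt ∞ (fun y ↦ G y i j) x := g.contMDiffAt_pair (hs j) (hs i)
  let c (y : M) i : ℝ := e.localFrameCoeff I b i y (Y y)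
  have solve : ∀ y ∈ e.baseSet, (G y).mulVec (c y) = fun i ↦ g.pair Y (s i) y := by
    intro y hy
    ext i
    have hsum := e.eq_sum_localFrameCoeff_smul (I := I) (b := b) (s := Y) hy
    simp only [pair]
    rw [hsum]
    simp [G, Matrix.mulVec, dotProduct, pair, c, s, map_sum, mul_comm]
  -- A kernel vector of the Gram matrix would be orthogonal to the whole frame.
  have det_ne : ∀ y ∈ e.baseSet, (G y).det ≠ 0 := by
    intro y hy h0
    obtain ⟨v, hv, hGv⟩ := Matrix.exists_mulVec_eq_zero_iff.2 h0
    apply hv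
    have hz : ∑ j, v j • e.basisAt b hy j = 0 := by
      refine g.ext_form fun w ↦ ?_
      suffices hfun : (g.form y (∑ j, v j • e.basisAt b hy j)).toLinearMap = 0 by
        simpa using LinearMap.congr_fun hfun w
      refine (e.basisAt b hy).ext fun i ↦ ?_
      have := congrFun hGv i
      simpa [G, Matrix.mulVec, dotProduct, pair, s, hy, mul_comm] using this
    exact funext (Fintype.linearIndependent_iff.1 (e.basisAt b hy).linearIndependent v hz)
  rw [contMDiffAt_iff_localFrameCoeff (e := e) b hx]
  intro i
  have hdet := contMDiffAt_det hG
  have hnum : CMDiffAt ∞ (fun y ↦ ((G y).updateCol i fun i ↦ g.pair Y (s i) y).det) x := by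
    refine contMDiffAt_det fun k l ↦ ?_
    by_cases hl : l = i
    · subst hl
      simpa using h _ (hs k)
    · simpa [Matrix.updateCol_apply, hl] using hG k l
  refine (hnum.div₀ hdet (det_ne x hx)).congr_of_eventuallyEq ?_
  filter_upwards [e.open_baseSet.mem_nhds hx] with y hy
  rw [Pi.div_apply, eq_div_iff (det_ne y hy), ← Matrix.cramer_apply, ← solve y hy,
    Matrix.cramer_eq_adjugate_mulVec, Matrix.mulVec_mulVec, Matrix.adjugate_mul]
  simp [c, Matrix.smul_mulVec, mul_comm]

lemma contMDiffAt_nabla (hX : CMDiffAt ∞ (T% X) x) (hY : CMDiffAt ∞ (T% Y) x) :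
    CMDiffAt ∞ (T% (g.nabla X Y)) x := by
  refine g.contMDiffAt_of_pair fun Z hZ ↦ ?_
  refine (g.contMDiffAt_koszul hX hY hZ).congr_of_eventuallyEq ?_
  filter_upwards [hX.eventually_mdifferentiableAt_section,
    hY.eventually_mdifferentiableAt_section, hZ.eventually_mdifferentiableAt_section]
    with y hXy hYy hZy using g.pair_nabla hXy hYy hZy

lemma nabla_congr (hY : MDiffAt (T% Y) x) (hZ : MDiffAt (T% Z) x) (h : ∀ᶠ y in nhds x, Y y = Z y)
    (X : Π x : M, TangentSpace I x) : g.nabla X Y x = g.nabla X Z x := by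
  rw [nabla, nabla]
  exact congrArg (· (X x)) (g.leviCivita.isCovariantDerivativeOnUniv.congr_of_eventuallyEq
    hY hZ Filter.univ_mem h)

lemma nabla_add_smul {f : M → ℝ} (hf : MDiffAt f x) (hY : MDiffAt (T% Y) x)
    (hZ : MDiffAt (T% Z) x) (X : Π x : M, TangentSpace I x) :
    g.nabla X (Y + f • Z) x =
      g.nabla X Y x + f x • g.nabla X Z x + d% f x (X x) • Z x := by
  have h := g.leviCivita.isCovariantDerivativeOnUniv
  simp only [nabla]
  rw [h.add hY (hf.smul_section hZ), h.leibniz hZ hf]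
  simp [add_assoc]

/-- An operation on vector fields that is torsion free and metric at `x` agrees there with the
Levi-Civita connection. -/
lemma nabla_unique {D : (Π x : M, TangentSpace I x) → (Π x : M, TangentSpace I x) →
    Π x : M, TangentSpace I x}
    (tor : ∀ X Y : Π x : M, TangentSpace I x, MDiffAt (T% X) x → MDiffAt (T% Y) x →
      D X Y x - D Y X x = mlieBracket I X Y x)
    (met : ∀ X Y Z : Π x : M, TangentSpace I x, MDiffAt (T% X) x → MDiffAt (T% Y) x →
      MDiffAt (T% Z) x → d% (g.pair Y Z) x (X x) = g.pair (D X Y) Z x + g.pair Y (D X Z) x)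
    (hX : MDiffAt (T% X) x) (hY : MDiffAt (T% Y) x) : g.nabla X Y x = D X Y x := by
  refine g.ext_pair fun Z hZ ↦ ?_
  rw [g.pair_nabla hX hY hZ, koszul, met X Y Z hX hY hZ, met Y Z X hY hZ hX, met Z X Y hZ hX hY]
  simp only [pair, ← tor X Y hX hY, ← tor Y Z hY hZ, ← tor Z X hZ hX, map_sub, sub_apply]
  rw [g.symm x (Y x) (D X Z x), g.symm x (Z x) (D Y X x), g.symm x (X x) (D Z Y x)]
  ring

end Regularity
end PseudoRiemannianMetric

/-! ### Coordinate vector fields and integral manifolds -/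

section Coordinate

variable {E : Type*} [NormedAddCommGroup E] [NormedSpace ℝ E]
  {H : Type*} [TopologicalSpace H] (I : ModelWithCorners ℝ E H)
  {M : Type*} [TopologicalSpace M] [ChartedSpace H M] [IsManifold I ∞ M]

/-- The coordinate vector field, in the chart at `x`, with constant coefficient vector `u`. It is
meaningful on the source of the chart only. -/
noncomputable def coordField (x : M) (u : E) : Π y : M, TangentSpace I y :=
  mpullback I 𝓘(ℝ, E) (extChartAt I x) fun _ ↦ u

variable {I} {x : M}

omit [IsManifold I ∞ M] in
lemma coordField_sum_smul {ι : Type*} (s : Finset ι) (c : ι → ℝ) (u : ι → E) (y : M) :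
    coordField I x (∑ i ∈ s, c i • u i) y = ∑ i ∈ s, c i • coordField I x (u i) y := by
  simp only [coordField]
  exact (map_sum _ _ _).trans (Finset.sum_congr rfl fun i _ ↦ map_smul _ _ _)

lemma coordField_mfderiv_extChartAt {y : M} (hy : y ∈ (extChartAt I x).source)
    (v : TangentSpace I y) :
    coordField I x (mfderiv I 𝓘(ℝ, E) (extChartAt I x) y v) y = v := by
  have : IsManifold I 1 M := IsManifold.of_le (n := ∞) (by simp)
  exact (isInvertible_mfderiv_extChartAt hy).inverse_apply_eq.2 rfl

lemma mdifferentiableAt_const_vectorField (u z : E) :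
    MDifferentiableAt 𝓘(ℝ, E) 𝓘(ℝ, E).tangent
      (fun z : E ↦ (TotalSpace.mk' E z u : TangentBundle 𝓘(ℝ, E) E)) z :=
  (contMDiffAt_vectorSpace_iff_contDiffAt (n := 1).2 contDiffAt_const).mdifferentiableAt (by simp)

variable [CompleteSpace E]

lemma mdifferentiableAt_coordField (u : E) : MDiffAt (T% (coordField I x u)) x := by
  have : IsManifold I 1 M := IsManifold.of_le (n := ∞) (by simp)
  have : IsManifold I 2 M := IsManifold.of_le (n := ∞) (WithTop.coe_le_coe.2 le_top)
  exact MDifferentiableAt.mpullback_vectorField (mdifferentiableAt_const_vectorField u _)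
    (contMDiffAt_extChartAt (n := 2))
    (isInvertible_mfderiv_extChartAt (mem_extChartAt_source x)) le_rfl

lemma mlieBracket_coordField (u w : E) :
    mlieBracket I (coordField I x u) (coordField I x w) x = 0 := by
  have : IsManifold I (minSmoothness ℝ 3) M := isManifold_minSmoothness I M 3
  have : IsManifold I 2 M := IsManifold.of_le (n := ∞) (WithTop.coe_le_coe.2 le_top)
  have h := mpullback_mlieBracket (I := I) (I' := 𝓘(ℝ, E)) (x₀ := x) (f := extChartAt I x)
    (n := 2) (mdifferentiableAt_const_vectorField u _) (mdifferentiableAt_const_vectorField w _)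
    contMDiffAt_extChartAt (by simp [minSmoothness_of_isRCLikeNormedField])
  have h0 : ∀ V W : Π z : E, TangentSpace 𝓘(ℝ, E) z, (V = fun _ ↦ u) → (W = fun _ ↦ w) →
      mlieBracket 𝓘(ℝ, E) V W = 0 := by
    intro V W hV hW
    rw [← mlieBracketWithin_univ, mlieBracketWithin_eq_lieBracketWithin, hV, hW]
    ext z
    simp [lieBracketWithin]
    rfl
  rw [coordField, coordField, ← h]
  exact (congrArg (fun W ↦ mpullback I 𝓘(ℝ, E) (extChartAt I x) W x) (h0 _ _ rfl rfl)).trans (by simp)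

/-- Along a map `φ` all of whose tangent vectors are annihilated by a one-form `α`, the exterior
derivative of `α` vanishes on pairs of tangent vectors of `φ`, that is `φ^* dα = d(φ^* α) = 0`.
Since coordinate vector fields have vanishing brackets, `dα` of two of them is the difference of
the two sides of this equation. -/
lemma mvfderiv_coordField_comm [FiniteDimensional ℝ E] {V : Type*} [NormedAddCommGroup V]
    [NormedSpace ℝ V] {U : Set V} (hU : IsOpen U) {φ : V → M} (hφ : CMDiff[U] ∞ φ) {s₀ : V}
    (hs₀ : s₀ ∈ U) {α : Π y : M, TangentSpace I y →L[ℝ] ℝ}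
    (hα : ∀ Y : Π y : M, TangentSpace I y, MDiffAt (T% Y) (φ s₀) →
      MDiffAt (fun y ↦ α y (Y y)) (φ s₀))
    (hker : ∀ s ∈ U, ∀ w : V, α (φ s) (mfderiv 𝓘(ℝ, V) I φ s w) = 0) (v w : V) :
    let D (w : V) : E := mfderiv I 𝓘(ℝ, E) (extChartAt I (φ s₀)) (φ s₀) (mfderiv 𝓘(ℝ, V) I φ s₀ w)
    d% (fun y ↦ α y (coordField I (φ s₀) (D w) y)) (φ s₀) (mfderiv 𝓘(ℝ, V) I φ s₀ v) =
      d% (fun y ↦ α y (coordField I (φ s₀) (D v) y)) (φ s₀) (mfderiv 𝓘(ℝ, V) I φ s₀ w) := by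
  intro D
  have : IsManifold I 1 M := IsManifold.of_le (n := ∞) (by simp)
  have hφU : ∀ s ∈ U, MDifferentiableAt 𝓘(ℝ, V) I φ s := fun s hs ↦
    (hφ.contMDiffAt (hU.mem_nhds hs)).mdifferentiableAt (by simp)
  set x := φ s₀
  let c : V → E := extChartAt I x ∘ φ
  let b := Module.finBasis ℝ E
  let a (u : E) (s : V) : ℝ := α (φ s) (coordField I x u (φ s))
  have near : ∀ᶠ s in nhds s₀, s ∈ U ∧ φ s ∈ (extChartAt I x).source :=
    Filter.Eventually.and (hU.mem_nhds hs₀) ((hφU s₀ hs₀).continuousAt.eventually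
      (extChartAt_source_mem_nhds (I := I) x))
  have hc : ContDiffAt ℝ 2 c s₀ := by
    refine ContMDiffAt.contDiffAt ?_
    exact (contMDiffAt_extChartAt (n := ∞)).of_le (WithTop.coe_le_coe.2 le_top) |>.comp s₀
      ((hφ.contMDiffAt (hU.mem_nhds hs₀)).of_le (WithTop.coe_le_coe.2 le_top))
  have hDc : ∀ᶠ s in nhds s₀, ∀ w, fderiv ℝ c s w =
      mfderiv I 𝓘(ℝ, E) (extChartAt I x) (φ s) (mfderiv 𝓘(ℝ, V) I φ s w) := by
    filter_upwards [near] with s hs w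
    rw [← mfderiv_eq_fderiv]
    exact mfderiv_comp_apply s (mdifferentiableAt_extChartAt (by simpa using hs.2)) (hφU s hs.1) w
  have ha (u : E) : ∃ L : V →L[ℝ] ℝ, HasFDerivAt (a u) L s₀ ∧ ∀ v : V, L v =
      d% (fun y ↦ α y (coordField I x u y)) x (mfderiv 𝓘(ℝ, V) I φ s₀ v) := by
    have h := hα _ (mdifferentiableAt_coordField u)
    exact ⟨_, (h.hasMFDerivAt.comp s₀ (hφU s₀ hs₀).hasMFDerivAt).hasFDerivAt, fun v ↦ rfl⟩
  choose L ha hL using ha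
  -- Expanding in constant-coefficient fields separates the dependence on `s` of the coefficients
  -- from that of the base point.
  have expand (u : E) (s : V) : a u s = ∑ i, b.repr u i * a (b i) s := by
    simp only [a]
    conv_lhs => rw [← b.sum_repr u, coordField_sum_smul]
    simp
  have da (u : E) (v : V) : d% (fun y ↦ α y (coordField I x u y)) x (mfderiv 𝓘(ℝ, V) I φ s₀ v) =
      ∑ i, b.repr u i *
        d% (fun y ↦ α y (coordField I x (b i) y)) x (mfderiv 𝓘(ℝ, V) I φ s₀ v) := by
    have h := HasFDerivAt.fun_sum (u := Finset.univ)
      fun i _ ↦ (ha (b i)).const_mul (b.repr u i)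
    have := (h.congr_of_eventuallyEq (.of_forall (expand u))).unique (ha u)
    simpa [hL] using (DFunLike.congr_fun this v).symm
  -- Differentiate the identity `α (Dφ(s) w) = 0` in `s`, with `Dφ(s) w` written as the
  -- coordinate field with coefficients `Dc(s) w`.
  have second (v w : V) : a (fderiv ℝ (fderiv ℝ c) s₀ v w) s₀ +
      d% (fun y ↦ α y (coordField I x (D w) y)) x (mfderiv 𝓘(ℝ, V) I φ s₀ v) = 0 := by
    have hd : HasFDerivAt (fun s ↦ fderiv ℝ c s w)
        ((ContinuousLinearMap.apply ℝ E w).comp (fderiv ℝ (fderiv ℝ c) s₀)) s₀ :=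
      (ContinuousLinearMap.apply ℝ E w).hasFDerivAt.comp s₀
        ((hc.fderiv_right (m := 1) (by norm_num)).differentiableAt (by simp)).hasFDerivAt
    have hcoord (i) : HasFDerivAt (fun s ↦ b.repr (fderiv ℝ c s w) i)
        ((b.coord i).toContinuousLinearMap.comp
          ((ContinuousLinearMap.apply ℝ E w).comp (fderiv ℝ (fderiv ℝ c) s₀))) s₀ :=
      (b.coord i).toContinuousLinearMap.hasFDerivAt.comp s₀ hd
    have h := HasFDerivAt.fun_sum (u := Finset.univ) fun i _ ↦ (hcoord i).mul (ha (b i))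
    have zero : (fun _ : V ↦ (0 : ℝ)) =ᶠ[nhds s₀]
        fun s ↦ ∑ i, b.repr (fderiv ℝ c s w) i * a (b i) s := by
      filter_upwards [near, hDc] with s hs hsc
      rw [← expand, hsc]
      simp only [a]
      rw [coordField_mfderiv_extChartAt hs.2, hker s hs.1]
    have hv := DFunLike.congr_fun ((h.congr_of_eventuallyEq zero).unique (hasFDerivAt_const _ _)) v
    rw [da, expand, ← Finset.sum_add_distrib]
    have hD : D w = fderiv ℝ c s₀ w := (hDc.self_of_nhds w).symm
    rw [hD]
    simp [hL] at hv
    rw [← hv]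
    refine Finset.sum_congr rfl fun i _ ↦ ?_
    ring
  -- The second derivative of `c` is symmetric, so its contribution cancels.
  have symm := hc.isSymmSndFDerivAt (by simp [minSmoothness_of_isRCLikeNormedField]) v w
  have h1 := second v w
  have h2 := second w v
  rw [symm] at h1
  linarith

end Coordinate

/-! ### Symmetry of `∇T♭` -/

namespace PseudoRiemannianMetric

section Symmetry

variable {E : Type*} [NormedAddCommGroup E] [NormedSpace ℝ E]
  {H : Type*} [TopologicalSpace H] {I : ModelWithCorners ℝ E H}
  {M : Type*} [TopologicalSpace M] [ChartedSpace H M] [IsManifold I ∞ M]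
  [CompleteSpace E] [FiniteDimensional ℝ E]
  (g : PseudoRiemannianMetric I M) {T X Y Z : Π x : M, TangentSpace I x} {x : M}

lemma nablaForm_flatForm_eq_sub (T X Y : Π x : M, TangentSpace I x) (x : M) :
    g.nablaForm (g.flatForm T) X Y x =
      d% (g.pair T Y) x (X x) - g.form x (T x) (g.nabla X Y x) := rfl

/-- Since the connection is metric, `∇T♭ = g(∇T, ·)`. -/
lemma nablaForm_flatForm (hT : MDiffAt (T% T) x) (hX : MDiffAt (T% X) x)
    (hY : MDiffAt (T% Y) x) :
    g.nablaForm (g.flatForm T) X Y x = g.form x (g.nabla X T x) (Y x) := by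
  rw [nablaForm_flatForm_eq_sub, g.mvfderiv_pair hX hT hY]
  simp [pair]

lemma contMDiffAt_nablaForm_flatForm (hT : CMDiffAt ∞ (T% T) x) (hX : CMDiffAt ∞ (T% X) x)
    (hY : CMDiffAt ∞ (T% Y) x) : CMDiffAt ∞ (g.nablaForm (g.flatForm T) X Y) x :=
  (contMDiffAt_mvfderiv_apply (g.contMDiffAt_pair hT hY) hX).sub
    (g.contMDiffAt_pair hT (g.contMDiffAt_nabla hX hY))

lemma form_leviCivita_self_eq_zero (hT : MDiffAt (T% T) x) {c : ℝ}
    (hunit : ∀ y, g.form y (T y) (T y) = c) (u : TangentSpace I x) :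
    g.form x (g.leviCivita T x u) (T x) = 0 := by
  have h := g.mvfderiv_pair (X := FiberBundle.extend E u)
    (FiberBundle.mdifferentiableAt_extend ..) hT hT
  have hconst : g.pair T T = fun _ ↦ c := funext hunit
  rw [hconst, mvfderiv_const, g.pair_comm T] at h
  simp only [pair, nabla, FiberBundle.extend_apply_self, zero_apply] at h
  linarith

/-- On vectors tangent to the integral manifolds of `T^⊥`, the form `g(∇T, ·)` is, up to sign,
their second fundamental form, hence symmetric. -/
lemma form_leviCivita_comm_of_integrable (hT : ∀ x, MDiffAt (T% T) x)
    (hint : IsIntegrableDistribution (g.normalBundle T)) {u w : TangentSpace I x}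
    (hu : g.form x (T x) u = 0) (hw : g.form x (T x) w = 0) :
    g.form x (g.leviCivita T x u) w = g.form x (g.leviCivita T x w) u := by
  obtain ⟨k, U, φ, hU, h0, rfl, hφ, htan⟩ := hint x
  have mem {v : TangentSpace I (φ 0)} (hv : g.form (φ 0) (T (φ 0)) v = 0) :
      ∃ s, mfderiv (𝓡 k) I φ 0 s = v := by
    have : v ∈ g.normalBundle T (φ 0) := LinearMap.mem_ker.2 hv
    rw [← (htan 0 h0).2] at this
    exact this
  obtain ⟨v₁, rfl⟩ := mem hu
  obtain ⟨v₂, rfl⟩ := mem hw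
  have comm := mvfderiv_coordField_comm hU hφ h0 (α := g.flatForm T)
    (fun Y hY ↦ g.mdifferentiableAt_pair (hT _) hY)
    (fun s hs w ↦ by
      have : mfderiv (𝓡 k) I φ s w ∈ g.normalBundle T (φ s) := by
        rw [← (htan s hs).2]
        exact ⟨w, rfl⟩
      exact LinearMap.mem_ker.1 this) v₁ v₂
  have value (v) : coordField I (φ 0) (mfderiv I 𝓘(ℝ, E) (extChartAt I (φ 0)) (φ 0)
      (mfderiv (𝓡 k) I φ 0 v)) (φ 0) = mfderiv (𝓡 k) I φ 0 v :=
    coordField_mfderiv_extChartAt (mem_extChartAt_source _) _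
  set F : EuclideanSpace ℝ (Fin k) → Π y : M, TangentSpace I y := fun v ↦
    coordField I (φ 0) (mfderiv I 𝓘(ℝ, E) (extChartAt I (φ 0)) (φ 0) (mfderiv (𝓡 k) I φ 0 v))
  have hFd (v) : MDiffAt (T% (F v)) (φ 0) := mdifferentiableAt_coordField _
  have form_eq (v w) : g.form (φ 0) (g.leviCivita T (φ 0) (mfderiv (𝓡 k) I φ 0 v))
      (mfderiv (𝓡 k) I φ 0 w) = d% (g.pair T (F w)) (φ 0) (mfderiv (𝓡 k) I φ 0 v)
        - g.form (φ 0) (T (φ 0)) (g.nabla (F v) (F w) (φ 0)) := by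
    have h := g.nablaForm_flatForm (hT _) (hFd v) (hFd w)
    rw [nablaForm_flatForm_eq_sub] at h
    simp only [F, nabla, value] at h ⊢
    exact h.symm
  have tor := g.nabla_sub_nabla (hFd v₁) (hFd v₂)
  rw [show mlieBracket I (F v₁) (F v₂) (φ 0) = 0 from mlieBracket_coordField _ _,
    sub_eq_zero] at tor
  rw [form_eq, form_eq, tor]
  exact congrArg (· - _) comm

/-- Symmetry of `∇T♭`: it is symmetric on `T^⊥` by integrability, while `∇_T T = 0` and
`g(∇T, T) = 0` make both of its contractions with `T` vanish. -/
lemma form_leviCivita_comm (hT : ∀ x, MDiffAt (T% T) x)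
    (hunit : ∀ y, g.form y (T y) (T y) = 1) (hgeod : g.HasGeodesicFlow T)
    (hint : IsIntegrableDistribution (g.normalBundle T)) (u w : TangentSpace I x) :
    g.form x (g.leviCivita T x u) w = g.form x (g.leviCivita T x w) u := by
  have hTT : g.leviCivita T x (T x) = 0 := hgeod x
  -- Compare `u` and `w` with their projections to `T^⊥`.
  have key := g.form_leviCivita_comm_of_integrable (x := x) hT hint
    (u := u - g.form x (T x) u • T x) (w := w - g.form x (T x) w • T x)
    (by simp [hunit]) (by simp [hunit])
  simpa [hTT, g.form_leviCivita_self_eq_zero (hT x) hunit] using key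

end Symmetry
end PseudoRiemannianMetric

/-! ### The Lorentzian counterpart -/

section Lorentz

variable {E : Type*} [NormedAddCommGroup E] [NormedSpace ℝ E]
  {H : Type*} [TopologicalSpace H] {I : ModelWithCorners ℝ E H}
  {M : Type*} [TopologicalSpace M] [ChartedSpace H M] [IsManifold I ∞ M]
  (g : ContMDiffRiemannianMetric I ∞ E (fun x : M ↦ TangentSpace I x))
  {T X Y Z : Π x : M, TangentSpace I x} {x : M}
  (hT : ContMDiff I I.tangent ∞ (T% T)) (hunit : ∀ x, g.inner x (T x) (T x) = 1)

open PseudoRiemannianMetric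

lemma lorentzCounterpart_form (x : M) (v w : TangentSpace I x) :
    (lorentzCounterpart g T hT hunit).form x v w = (ofRiemannian g).form x v w
      - 2 * ((ofRiemannian g).form x (T x) v * (ofRiemannian g).form x (T x) w) := by
  simp [lorentzCounterpart, ofRiemannian]

lemma isLorentzian_lorentzCounterpart : (lorentzCounterpart g T hT hunit).IsLorentzian := by
  have hunit' (y) : (ofRiemannian g).form y (T y) (T y) = 1 := hunit y
  refine fun x ↦ ⟨T x, ?_, fun v hv hv0 ↦ ?_⟩
  · rw [lorentzCounterpart_form, hunit']
    norm_num
  · rw [lorentzCounterpart_form, hunit'] at hv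
    have hv' : (ofRiemannian g).form x (T x) v = 0 := by linarith
    rw [lorentzCounterpart_form, hv']
    simpa [ofRiemannian] using g.pos x v hv0

variable [CompleteSpace E] [FiniteDimensional ℝ E]

/-- The Levi-Civita connections of the two metrics: `∇^L_X Y = ∇_X Y + 2 (∇T♭)(X, Y) T`. -/
lemma nabla_lorentzCounterpart (hgeod : (ofRiemannian g).HasGeodesicFlow T)
    (hint : IsIntegrableDistribution ((ofRiemannian g).normalBundle T))
    (hX : MDiffAt (T% X) x) (hY : MDiffAt (T% Y) x) :
    (lorentzCounterpart g T hT hunit).nabla X Y x = (ofRiemannian g).nabla X Y x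
      + (2 * (ofRiemannian g).nablaForm ((ofRiemannian g).flatForm T) X Y x) • T x := by
  have hunit' (y) : (ofRiemannian g).form y (T y) (T y) = 1 := hunit y
  have hTd (y) : MDiffAt (T% T) y := (hT y).mdifferentiableAt (by simp)
  set g₀ := ofRiemannian g
  refine nabla_unique _ (D := fun X Y y ↦ g₀.nabla X Y y
    + (2 * g₀.nablaForm (g₀.flatForm T) X Y y) • T y) ?_ ?_ hX hY
  · intro X Y hX hY
    have hs := g₀.form_leviCivita_comm hTd hunit' hgeod hint (X x) (Y x)
    simp only [g₀.nablaForm_flatForm (hTd x) hX hY, g₀.nablaForm_flatForm (hTd x) hY hX]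
    rw [nabla, nabla, hs, ← g₀.nabla_sub_nabla hX hY]
    simp only [nabla]
    abel
  · intro X Y Z hX hY hZ
    have hpair : (lorentzCounterpart g T hT hunit).pair Y Z =
        g₀.pair Y Z - (fun _ ↦ (2 : ℝ)) * (g₀.pair T Y * g₀.pair T Z) := by
      ext y
      exact lorentzCounterpart_form g hT hunit y (Y y) (Z y)
    have hform (v w) : (lorentzCounterpart g T hT hunit).form x v w =
        g₀.form x v w - 2 * (g₀.form x (T x) v * g₀.form x (T x) w) :=
      lorentzCounterpart_form g hT hunit x v w
    have hTY := g₀.mdifferentiableAt_pair (hTd x) hY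
    have hTZ := g₀.mdifferentiableAt_pair (hTd x) hZ
    have h2 : MDiffAt (fun _ : M ↦ (2 : ℝ)) x := mdifferentiableAt_const
    rw [hpair, mvfderiv_sub (g₀.mdifferentiableAt_pair hY hZ) (h2.mul (hTY.mul hTZ)),
      mvfderiv_mul h2 (hTY.mul hTZ), mvfderiv_mul hTY hTZ, mvfderiv_const]
    simp only [sub_apply, add_apply, smul_apply, smul_zero, add_zero, smul_eq_mul,
      g₀.mvfderiv_pair hX hY hZ, g₀.nablaForm_flatForm_eq_sub, pair, hform,
      map_add, map_smul, hunit', Pi.mul_apply]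
    rw [g₀.symm x (Y x) (T x)]
    ring

/-- The second covariant derivatives of the two metrics. Expanding `∇T♭(b, c) = b(T♭(c)) - T♭(∇_b c)`
makes the terms `g(∇_a T, ∇_b c)` cancel, so that the coefficient of `T` becomes
`2 (a(b(T♭(c))) - T♭(∇_a ∇_b c))`. -/
lemma nabla_nabla_lorentzCounterpart (hgeod : (ofRiemannian g).HasGeodesicFlow T)
    (hint : IsIntegrableDistribution ((ofRiemannian g).normalBundle T))
    {a b c : Π x : M, TangentSpace I x}
    (ha : CMDiffAt ∞ (T% a) x) (hb : CMDiffAt ∞ (T% b) x) (hc : CMDiffAt ∞ (T% c) x) :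
    (lorentzCounterpart g T hT hunit).nabla a ((lorentzCounterpart g T hT hunit).nabla b c) x =
      (ofRiemannian g).nabla a ((ofRiemannian g).nabla b c) x
      + (2 * (ofRiemannian g).nablaForm ((ofRiemannian g).flatForm T) b c x) •
        (ofRiemannian g).nabla a T x
      + (2 * (d% (fun y ↦ d% ((ofRiemannian g).pair T c) y (b y)) x (a x)
        - (ofRiemannian g).form x (T x)
          ((ofRiemannian g).nabla a ((ofRiemannian g).nabla b c) x))) • T x := by
  have hunit' (y) : (ofRiemannian g).form y (T y) (T y) = 1 := hunit y
  have hTd (y) : MDiffAt (T% T) y := (hT y).mdifferentiableAt (by simp)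
  set g₀ := ofRiemannian g
  set gL := lorentzCounterpart g T hT hunit
  let h : M → ℝ := g₀.nablaForm (g₀.flatForm T) b c
  have hh : CMDiffAt ∞ h x := g₀.contMDiffAt_nablaForm_flatForm (hT x) hb hc
  let f : M → ℝ := (fun _ ↦ (2 : ℝ)) * h
  have h2 : MDiffAt (fun _ : M ↦ (2 : ℝ)) x := mdifferentiableAt_const
  have hf : MDiffAt f x := h2.mul (hh.mdifferentiableAt (by simp))
  have hbc := g₀.contMDiffAt_nabla hb hc
  have hbcd : MDiffAt (T% (g₀.nabla b c)) x := hbc.mdifferentiableAt (by simp)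
  have had : MDiffAt (T% a) x := ha.mdifferentiableAt (by simp)
  have hY : MDiffAt (T% (g₀.nabla b c + f • T)) x :=
    mdifferentiableAt_add_section hbcd (hf.smul_section (hTd x))
  have hcongr : gL.nabla a (gL.nabla b c) x = gL.nabla a (g₀.nabla b c + f • T) x := by
    refine gL.nabla_congr ((gL.contMDiffAt_nabla hb hc).mdifferentiableAt (by simp)) hY ?_ a
    filter_upwards [hb.eventually_mdifferentiableAt_section,
      hc.eventually_mdifferentiableAt_section] with y hby hcy
    exact nabla_lorentzCounterpart g hT hunit hgeod hint hby hcy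
  have df : d% f x (a x) = 2 * (d% (fun y ↦ d% (g₀.pair T c) y (b y)) x (a x)
      - g₀.form x (g₀.nabla a T x) (g₀.nabla b c x)
      - g₀.form x (T x) (g₀.nabla a (g₀.nabla b c) x)) := by
    have h1 := (contMDiffAt_mvfderiv_apply (g₀.contMDiffAt_pair (hT x) hc) hb).mdifferentiableAt
      (by simp)
    have e : h = (fun y ↦ d% (g₀.pair T c) y (b y)) - g₀.pair T (g₀.nabla b c) := rfl
    have e' := g₀.mvfderiv_pair had (hTd x) hbcd
    simp only [f]
    rw [mvfderiv_mul h2 (hh.mdifferentiableAt (by simp)), mvfderiv_const, e,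
      mvfderiv_sub h1 (g₀.mdifferentiableAt_pair (hTd x) hbcd)]
    simp only [smul_apply, sub_apply, e', smul_zero, add_zero, smul_eq_mul, pair]
    ring
  rw [hcongr, nabla_lorentzCounterpart g hT hunit hgeod hint had hY,
    g₀.nablaForm_flatForm (hTd x) had hY, g₀.nabla_add_smul hf hbcd (hTd x), df]
  have hAT : g₀.form x (g₀.nabla a T x) (T x) = 0 :=
    g₀.form_leviCivita_self_eq_zero (hTd x) hunit' _
  simp only [Pi.add_apply, Pi.smul_apply', map_add, map_smul, hAT, smul_zero, add_zero, f,
    Pi.mul_apply, h]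
  module

/-- The curvature of the Lorentzian counterpart. By the commutator formula, the
coefficient of `T` in `R_L(a, b)c` is `- 2 T♭(R(a, b)c)`; paired with `d`, this cancels the term by
which `g_L` differs from `g` on `R(a, b)c`, and only the products of `∇T♭` are left. -/
lemma Rm_lorentzCounterpart (hgeod : (ofRiemannian g).HasGeodesicFlow T)
    (hint : IsIntegrableDistribution ((ofRiemannian g).normalBundle T))
    {a b c d : Π x : M, TangentSpace I x}
    (ha : CMDiffAt ∞ (T% a) x) (hb : CMDiffAt ∞ (T% b) x) (hc : CMDiffAt ∞ (T% c) x)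
    (hd : CMDiffAt ∞ (T% d) x) :
    (lorentzCounterpart g T hT hunit).Rm a b c d x = (ofRiemannian g).Rm a b c d x +
      kulkarniNomizu
        (fun X Y ↦ (ofRiemannian g).nablaForm ((ofRiemannian g).flatForm T) X Y x)
        (fun X Y ↦ (ofRiemannian g).nablaForm ((ofRiemannian g).flatForm T) X Y x) a b c d := by
  have hunit' (y) : (ofRiemannian g).form y (T y) (T y) = 1 := hunit y
  have hTd (y) : MDiffAt (T% T) y := (hT y).mdifferentiableAt (by simp)
  have hab := ha.mlieBracket_infty hb
  have hdd : MDiffAt (T% d) x := hd.mdifferentiableAt (by simp)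
  have e1 := nabla_nabla_lorentzCounterpart g hT hunit hgeod hint ha hb hc
  have e2 := nabla_nabla_lorentzCounterpart g hT hunit hgeod hint hb ha hc
  have e3 := nabla_lorentzCounterpart g hT hunit hgeod hint
    (hab.mdifferentiableAt (by simp)) (hc.mdifferentiableAt (by simp))
  rw [nablaForm_flatForm_eq_sub,
    mvfderiv_mlieBracket_apply (contMDiffAt_pair _ (hT x) hc) ha hb] at e3
  simp only [Rm, kulkarniNomizu]
  simp only [pair, e1, e2, e3, lorentzCounterpart_form]
  set g₀ := ofRiemannian g
  have hAT (v) : g₀.form x (T x) (g₀.nabla v T x) = 0 := by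
    rw [g₀.symm]
    exact g₀.form_leviCivita_self_eq_zero (hTd x) hunit' _
  rw [g₀.nablaForm_flatForm (hTd x) (ha.mdifferentiableAt (by simp)) hdd,
    g₀.nablaForm_flatForm (hTd x) (hb.mdifferentiableAt (by simp)) hdd]
  simp only [map_add, map_smul, add_apply, smul_apply, smul_eq_mul, hAT, hunit']
  ring

end Lorentz

theorem mainTheorem2 {n : ℕ} {M : Type*} [TopologicalSpace M]
    [ChartedSpace (EuclideanSpace ℝ (Fin n)) M] [IsManifold (𝓡 n) ∞ M]
    (g : ContMDiffRiemannianMetric (𝓡 n) ∞ (EuclideanSpace ℝ (Fin n))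
      (fun x : M ↦ TangentSpace (𝓡 n) x))
    (T : Π x : M, TangentSpace (𝓡 n) x)
    (hT : ContMDiff (𝓡 n) (𝓡 n).tangent ∞ (T% T))
    (hunit : ∀ x, g.inner x (T x) (T x) = 1)
    (hgeod : (PseudoRiemannianMetric.ofRiemannian g).HasGeodesicFlow T)
    (hint : IsIntegrableDistribution ((PseudoRiemannianMetric.ofRiemannian g).normalBundle T)) :
    letI g₀ := PseudoRiemannianMetric.ofRiemannian g
    letI gL := lorentzCounterpart g T hT hunit
    letI nablaFlat := g₀.nablaForm (g₀.flatForm T)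
    (∀ (x : M) (X Y : Π x : M, TangentSpace (𝓡 n) x),
      ContMDiffAt (𝓡 n) (𝓡 n).tangent ∞ (T% X) x →
      ContMDiffAt (𝓡 n) (𝓡 n).tangent ∞ (T% Y) x →
      nablaFlat X Y x = nablaFlat Y X x) ∧
    gL.IsLorentzian ∧
    ∀ (x : M) (a b c d : Π x : M, TangentSpace (𝓡 n) x),
      ContMDiffAt (𝓡 n) (𝓡 n).tangent ∞ (T% a) x →
      ContMDiffAt (𝓡 n) (𝓡 n).tangent ∞ (T% b) x →
      ContMDiffAt (𝓡 n) (𝓡 n).tangent ∞ (T% c) x →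
      ContMDiffAt (𝓡 n) (𝓡 n).tangent ∞ (T% d) x →
      gL.Rm a b c d x = g₀.Rm a b c d x +
        kulkarniNomizu (fun X Y ↦ nablaFlat X Y x) (fun X Y ↦ nablaFlat X Y x) a b c d := by
  have hTd (y : M) : MDifferentiableAt (𝓡 n) (𝓡 n).tangent (T% T) y := (hT y).mdifferentiableAt (by simp)
  refine ⟨fun x X Y hX hY ↦ ?_, isLorentzian_lorentzCounterpart g hT hunit,
    fun x a b c d ha hb hc hd ↦ Rm_lorentzCounterpart g hT hunit hgeod hint ha hb hc hd⟩
  have hXd := hX.mdifferentiableAt (by simp)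
  have hYd := hY.mdifferentiableAt (by simp)
  rw [PseudoRiemannianMetric.nablaForm_flatForm _ (hTd x) hXd hYd,
    PseudoRiemannianMetric.nablaForm_flatForm _ (hTd x) hYd hXd]
  exact PseudoRiemannianMetric.form_leviCivita_comm _ hTd hunit hgeod hint _ _
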